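/- **Theorem (generalised Moser inequality for mixed states).** Let $(X,\mu)$ be a $\sigma$-finite measure space, $H$ a complex Hilbert space and $\mathcal H=L^2(X,\mu;H)$. Let $A$ be a positive self-adjoint (possibly unbounded) operator on $\mathcal H$ with spectral projections $\chi_A(S)$, and let $\rho\neq 0$ be a positive bounded operator on $\mathcal H$ with operator norm $\|\rho\|$. For a positive bounded operator $P$ on $\mathcal H$ let $\nu_P$ be the measure $\nu_P(\Omega)=\tau(\chi_\Omega P\chi_\Omega)=\tau(P^{1/2}\chi_\Omega P^{1/2})\in[0,\infty]$ on $X$, where $\tau$ is the trace and $\chi_\Omega$ is multiplication by the indicator function of the measurable set $\Omega$; let $D\nu_P=\frac{d\nu_P}{d\mu}\colon X\to[0,\infty]$ be its density. Let $\mathcal E(\rho)=\tau(\rho^{1/2}A\rho^{1/2})=\sum_i\|A^{1/2}\rho^{1/2}e_i\|^2\in[0,\infty]$ for a Hilbert basis $(e_i)$ of $\mathcal H$, where $\|A^{1/2}v\|^2=\infty$ if $v$ is not in the domain of $A^{1/2}$. Suppose that either * $\rho=0$ on $\ker A$, and $F_x(\lambda)=D\nu_{\Pi_\lambda}(x)$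 with $\Pi_\lambda=\chi_A(\,]0,\lambda])$ for all $\lambda\ge 0$; or * $\rho$ is arbitrary, and $F_x(\lambda)=D\nu_{\Pi_\lambda}(x)$ with $\Pi_\lambda=\chi_A([0,\lambda])$ for all $\lambda\ge 0$. Here, densities being defined only $\mu$-almost everywhere, $(F_x(\lambda))$ is any choice of versions such that for $\mu$-almost every $x$ the function $\lambda\mapsto F_x(\lambda)\in[0,\infty]$ is nondecreasing. For $u\in[0,\infty]$ put $$F_x^{-1}(u)=\sup\{\lambda\ge 0 : F_x(\lambda)<\infty \text{ and } F_x(\lambda)\le u\}\in[0,\infty],\qquad \sup\emptyset=0.$$ Then $$\int_X F_x^{-1}\Bigl(\frac{D\nu_\rho(x)}{4\|\rho\|}\Bigr)\,d\nu_\rho(x)\le 4\,\mathcal E(\rho).$$ -/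

import Mathlib

open MeasureTheory Set
open scoped ENNReal NNReal InnerProductSpace

noncomputable section

namespace MixedState

section Hilbert

variable {E : Type*} [NormedAddCommGroup E] [InnerProductSpace ℂ E] [CompleteSpace E]

/-- A projection-valued measure on the Borel sets of `ℝ`, with values in the orthogonal projections
of `E`. The values on non-measurable sets are irrelevant. -/
structure ProjectionValuedMeasure (E : Type*) [NormedAddCommGroup E] [InnerProductSpace ℂ E]
    [CompleteSpace E] where
  /-- The projection attached to a set. -/
  proj : Set ℝ → (E →L[ℂ] E)
  isStarProjection : ∀ S, MeasurableSet S → IsStarProjection (proj S)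
  univ : proj univ = 1
  inter : ∀ S T, MeasurableSet S → MeasurableSet T → proj (S ∩ T) = proj S ∘L proj T
  iUnion : ∀ S : ℕ → Set ℝ, (∀ n, MeasurableSet (S n)) → Pairwise (fun m n => Disjoint (S m) (S n)) →
    ∀ v : E, HasSum (fun n => proj (S n) v) (proj (⋃ n, S n) v)

/-- The projection-valued Dirac measure at `0`, only used to know that the type is inhabited. -/
instance : Nonempty (ProjectionValuedMeasure E) := by
  classical
  refine ⟨{ proj := fun S => if (0 : ℝ) ∈ S then 1 else 0
            isStarProjection := ?_, univ := by simp, inter := ?_, iUnion := ?_ }⟩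
  · intro S _
    split_ifs
    · exact IsStarProjection.one _
    · exact IsStarProjection.zero _
  · intro S T _ _
    by_cases hS : (0 : ℝ) ∈ S <;> by_cases hT : (0 : ℝ) ∈ T <;> simp [hS, hT, ContinuousLinearMap.one_def]
  · intro S _ hd v
    by_cases h : ∃ n, (0 : ℝ) ∈ S n
    · obtain ⟨n, hn⟩ := h
      have h1 : (0 : ℝ) ∈ ⋃ n, S n := mem_iUnion.2 ⟨n, hn⟩
      have h2 : ∀ m, m ≠ n → (0 : ℝ) ∉ S m := fun m hm h0 =>
        Set.disjoint_left.1 (hd hm) h0 hn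
      rw [if_pos h1]
      have := hasSum_single (f := fun m => (if (0 : ℝ) ∈ S m then (1 : E →L[ℂ] E) else 0) v) n
        (fun m hm => by simp [h2 m hm])
      simpa [hn] using this
    · have h1 : (0 : ℝ) ∉ ⋃ n, S n := by simpa using h
      have h2 : ∀ n, (0 : ℝ) ∉ S n := by simpa using h
      simp only [if_neg h1, h2, if_false]
      simp

/-- The scalar spectral measure `S ↦ ⟨v, P(S) v⟩ = ‖P(S) v‖²` of a vector `v`. -/
def ProjectionValuedMeasure.scalar (P : ProjectionValuedMeasure E) (v : E) : Measure ℝ :=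
  Measure.ofMeasurable (fun S _ => ENNReal.ofReal (⟪v, P.proj S v⟫_ℂ).re)
    (by
      have h := P.iUnion (fun _ => ∅) (fun _ => MeasurableSet.empty) (fun _ _ _ => by simp) v
      have h0 : P.proj ∅ v = 0 := by
        exact (summable_const_iff _).1 h.summable
      simp [h0])
    (by
      intro S hS hd
      have h := P.iUnion S hS hd v
      have h1 : HasSum (fun n => (⟪v, P.proj (S n) v⟫_ℂ).re) (⟪v, P.proj (⋃ n, S n) v⟫_ℂ).re :=
        Complex.hasSum_re (h.mapL (innerSL ℂ v))
      rw [← h1.tsum_eq]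
      refine ENNReal.ofReal_tsum_of_nonneg (fun n => ?_) h1.summable
      have hp := (ContinuousLinearMap.IsPositive.of_isStarProjection
        (P.isStarProjection (S n) (hS n)))
      exact hp.re_inner_nonneg_right v)

/-- `P` is the spectral measure of the (unbounded) operator `A`, that is `A = ∫ t dP(t)`: the domain
of `A` consists of the `v` with `∫ t² d⟨v, P(t) v⟩ < ∞`, and `⟨v, A v⟩ = ∫ t d⟨v, P(t) v⟩` there. -/
def IsSpectralMeasure (A : E →ₗ.[ℂ] E) (P : ProjectionValuedMeasure E) : Prop :=
  (∀ v : E, v ∈ A.domain ↔ ∫⁻ t, ENNReal.ofReal (t ^ 2) ∂(P.scalar v) < ∞) ∧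
    ∀ v : A.domain, ⟪(v : E), A v⟫_ℂ = ((∫ t, t ∂(P.scalar (v : E)) : ℝ) : ℂ)

/-- The spectral measure of `A`. By the spectral theorem it exists, and is unique on Borel sets,
when `A` is self-adjoint; the value for other `A` is irrelevant. -/
def spectralMeasure (A : E →ₗ.[ℂ] E) : ProjectionValuedMeasure E :=
  Classical.epsilon (IsSpectralMeasure A)

/-- The spectral projection `χ_A(S)` of a self-adjoint operator `A`. -/
def spectralProjection (A : E →ₗ.[ℂ] E) (S : Set ℝ) : E →L[ℂ] E :=
  (spectralMeasure A).proj S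

/-- The closed quadratic form of a positive self-adjoint operator `A`: it is
`‖A^{1/2} v‖² = ∫ t d⟨v, χ_A(t) v⟩` on the domain of `A^{1/2}`, and `∞` elsewhere. -/
def quadraticForm (A : E →ₗ.[ℂ] E) (v : E) : ℝ≥0∞ :=
  ∫⁻ t, ENNReal.ofReal t ∂((spectralMeasure A).scalar v)

/-- The trace `∑ᵢ q(eᵢ)` of a nonnegative quadratic form `q` over a Hilbert basis `(eᵢ)`; for the
closed forms used here it does not depend on the basis. -/
def formTrace (q : E → ℝ≥0∞) : ℝ≥0∞ :=
  ∑' i : (exists_hilbertBasis ℂ E).choose, q (i : E)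

/-- The trace of a positive bounded operator, a value in `[0, ∞]`. -/
def trace (T : E →L[ℂ] E) : ℝ≥0∞ :=
  formTrace fun v => ENNReal.ofReal (⟪v, T v⟫_ℂ).re

/-- The positive square root of a positive bounded operator. -/
def opSqrt (T : E →L[ℂ] E) : E →L[ℂ] E := CFC.sqrt T

theorem inner_opSqrt_right (T : E →L[ℂ] E) (v w : E) : ⟪v, opSqrt T w⟫_ℂ = ⟪opSqrt T v, w⟫_ℂ := by
  have hs : IsSelfAdjoint (opSqrt T) := (CFC.sqrt_nonneg T).isSelfAdjoint
  rw [← ContinuousLinearMap.adjoint_inner_left, hs.adjoint_eq]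

/-- The energy `τ(ρ^{1/2} A ρ^{1/2})` of a positive bounded `ρ` for a positive self-adjoint `A`:
the trace of the form `v ↦ ‖A^{1/2} ρ^{1/2} v‖²`. -/
def energy (A : E →ₗ.[ℂ] E) (ρ : E →L[ℂ] E) : ℝ≥0∞ :=
  formTrace fun v => quadraticForm A (opSqrt ρ v)

end Hilbert

section Density

variable {X : Type*} [MeasurableSpace X] (μ : Measure X)
  {H : Type*} [NormedAddCommGroup H] [InnerProductSpace ℂ H]

/-- Multiplication by the indicator function of `Ω` on `L²(X, H)`. -/
def cutoff (Ω : Set X) (hΩ : MeasurableSet Ω) : Lp H 2 μ →L[ℂ] Lp H 2 μ :=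
  LinearMap.mkContinuous
    { toFun := fun f => ((Lp.memLp f).indicator hΩ).toLp (Ω.indicator f)
      map_add' := by
        intro f g
        rw [← MemLp.toLp_add]
        refine MemLp.toLp_congr _ _ ?_
        filter_upwards [Lp.coeFn_add f g] with x hx
        by_cases h : x ∈ Ω
        · simpa [h] using hx
        · simp [h]
      map_smul' := by
        intro c f
        rw [RingHom.id_apply, ← MemLp.toLp_const_smul]
        refine MemLp.toLp_congr _ _ ?_
        filter_upwards [Lp.coeFn_smul c f] with x hx
        by_cases h : x ∈ Ω
        · simpa [h] using hx
        · simp [h] }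
    1
    (by
      intro f
      rw [one_mul]
      refine Lp.norm_le_norm_of_ae_le ?_
      filter_upwards [((Lp.memLp f).indicator hΩ).coeFn_toLp] with x hx
      simp only [LinearMap.coe_mk, AddHom.coe_mk]
      rw [hx]
      exact norm_indicator_le_norm_self _ _)

theorem coeFn_cutoff (Ω : Set X) (hΩ : MeasurableSet Ω) (f : Lp H 2 μ) :
    cutoff μ Ω hΩ f =ᵐ[μ] Ω.indicator f :=
  ((Lp.memLp f).indicator hΩ).coeFn_toLp

theorem ofReal_inner_cutoff (Ω : Set X) (hΩ : MeasurableSet Ω) (f : Lp H 2 μ) :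
    ENNReal.ofReal (⟪f, cutoff μ Ω hΩ f⟫_ℂ).re = ∫⁻ x in Ω, ‖f x‖ₑ ^ 2 ∂μ := by
  have hm : MemLp (Ω.indicator f) 2 μ := (Lp.memLp f).indicator hΩ
  have hint := (memLp_two_iff_integrable_sq_norm hm.1).1 hm
  have h1 : ⟪f, cutoff μ Ω hΩ f⟫_ℂ = ((∫ x, ‖Ω.indicator f x‖ ^ 2 ∂μ : ℝ) : ℂ) := by
    rw [L2.inner_def, ← integral_complex_ofReal]
    refine integral_congr_ae ?_
    filter_upwards [coeFn_cutoff μ Ω hΩ f] with x hx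
    rw [hx]
    by_cases h : x ∈ Ω
    · simp [h, inner_self_eq_norm_sq_to_K]
    · simp [h]
  rw [h1, Complex.ofReal_re,
    ofReal_integral_eq_lintegral_ofReal hint (Filter.Eventually.of_forall fun x => by positivity),
    ← lintegral_indicator hΩ]
  refine lintegral_congr fun x => ?_
  by_cases h : x ∈ Ω
  · simp only [h, indicator_of_mem]
    rw [ENNReal.ofReal_pow (norm_nonneg _), ofReal_norm]
  · simp [h]

variable [CompleteSpace H]

theorem trace_sqrt_cutoff_sqrt (P : Lp H 2 μ →L[ℂ] Lp H 2 μ) (Ω : Set X) (hΩ : MeasurableSet Ω) :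
    trace (opSqrt P ∘L cutoff μ Ω hΩ ∘L opSqrt P) =
      formTrace fun v : Lp H 2 μ => ∫⁻ x in Ω, ‖opSqrt P v x‖ₑ ^ 2 ∂μ := by
  unfold trace
  congr 1
  funext v
  rw [← ofReal_inner_cutoff μ Ω hΩ]
  simp only [ContinuousLinearMap.comp_apply, inner_opSqrt_right]

/-- The measure `ν_P(Ω) = τ(P^{1/2} χ_Ω P^{1/2})` of a positive bounded operator `P`
on `L²(X, H)`. -/
def traceMeasure (P : Lp H 2 μ →L[ℂ] Lp H 2 μ) : Measure X :=
  Measure.ofMeasurable (fun Ω hΩ => trace (opSqrt P ∘L cutoff μ Ω hΩ ∘L opSqrt P))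
    (by rw [trace_sqrt_cutoff_sqrt]; simp [formTrace])
    (by
      intro S hS hd
      simp only [trace_sqrt_cutoff_sqrt, formTrace]
      rw [ENNReal.tsum_comm]
      exact tsum_congr fun i => lintegral_iUnion hS hd _)

/-- The density function `D ν_P = dν_P / dμ` of a positive bounded operator `P`. -/
def density (P : Lp H 2 μ →L[ℂ] Lp H 2 μ) : X → ℝ≥0∞ :=
  (traceMeasure μ P).rnDeriv μ

/-- `F x t` is the pointwise density at `x` of the increasing family `Q t` of projections. Each
density `D ν_{Q t}` is only defined up to a null set, hence one takes versions of these functions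
that are, for almost every `x`, nondecreasing in `t`. -/
def IsPointwiseDensity (Q : ℝ≥0 → (Lp H 2 μ →L[ℂ] Lp H 2 μ)) (F : X → ℝ≥0 → ℝ≥0∞) : Prop :=
  (∀ᵐ x ∂μ, Monotone (F x)) ∧ ∀ t : ℝ≥0, (fun x => F x t) =ᵐ[μ] density μ (Q t)

end Density

/-- The generalised inverse `u ↦ sup {t ≥ 0 | F t ≤ u}` of a nondecreasing `F`, with value `0` when
the set is empty. Only finite values of `F` count, which matters for `u = ∞` alone. -/
def genInverse (F : ℝ≥0 → ℝ≥0∞) (u : ℝ≥0∞) : ℝ≥0∞ :=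
  ⨆ (t : ℝ≥0) (_ : F t < ∞ ∧ F t ≤ u), (t : ℝ≥0∞)

end MixedState

end

noncomputable section

open Filter Topology

namespace MixedState

/-!
Cut the energy at a level `t`. The operator inequality
`ρ ≤ 2 ρ^{1/2} Q_t ρ^{1/2} + 2 ρ^{1/2} (1 - Q_t) ρ^{1/2}`, in the form
`‖v + w‖² ≤ 2‖v‖² + 2‖w‖²` for Hilbert–Schmidt norms over each set `Ω`, gives almost everywhere
`Dν_ρ ≤ 2 ‖ρ‖ Dν_{Q_t} + 2 D_t`, where `D_t` is a density of total mass
`τ(ρ^{1/2} (1 - Q_t) ρ^{1/2})`. Where `F_x(t) = Dν_{Q_t}(x)` is at most `Dν_ρ(x) / (4 ‖ρ‖)`, the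
first term is at most half of the left side, hence `Dν_ρ ≤ 4 D_t`. As `t < F_x⁻¹(u)` implies
`F_x(t) ≤ u`, this bounds the `ν_ρ`-measure of `{t < F_x⁻¹(Dν_ρ(x) / (4 ‖ρ‖))}` by
`4 τ(ρ^{1/2} χ_A(]t, ∞[) ρ^{1/2})`, and integrating over `t > 0` gives the two sides of the
inequality by the layer cake formula.

The spectral measure of `A` comes from its resolvent `r = (1 + A)⁻¹`: every vector `v` has a
spectral measure for the continuous functional calculus of `r` by the Riesz–Markov–Kakutani
theorem, bounded Borel functions of `r` act through the isometries `L²(m_v) → E`, and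
`A = r⁻¹ - 1`.
-/

section LpApproximation

variable {α : Type*} [MeasurableSpace α] {m m' : Measure α}

theorem memLp_indicator_one [IsFiniteMeasure m] {S : Set α} (hS : MeasurableSet S) (p : ℝ≥0∞) :
    MemLp (S.indicator (1 : α → ℝ)) p m :=
  (memLp_const (1 : ℝ)).indicator hS

theorem tendsto_eLpNorm_mul_of_bound {f : ℕ → α → ℝ} {p : ℝ≥0∞}
    (hf : Tendsto (fun n => eLpNorm (f n) p m) atTop (𝓝 0)) {g : α → ℝ} {C : ℝ}
    (hg : ∀ x, ‖g x‖ ≤ C) : Tendsto (fun n => eLpNorm (g * f n) p m) atTop (𝓝 0) := by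
  have h_lim : Tendsto (fun n => ENNReal.ofReal C * eLpNorm (f n) p m) atTop (𝓝 0) := by
    simpa using ENNReal.Tendsto.const_mul hf (Or.inr ENNReal.ofReal_ne_top)
  refine tendsto_of_tendsto_of_tendsto_of_le_of_le tendsto_const_nhds h_lim (fun _ => zero_le)
    fun n => eLpNorm_le_mul_eLpNorm_of_ae_le_mul (.of_forall fun x => ?_) _
  rw [Pi.mul_apply, norm_mul]
  gcongr
  exact hg x

theorem memLp_two_add_measure {g : α → ℝ} (hg : MemLp g 2 m) (hg' : MemLp g 2 m') :
    MemLp g 2 (m + m') := by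
  rw [memLp_two_iff_integrable_sq (hg.1.add_measure hg'.1)]
  exact hg.integrable_sq.add_measure hg'.integrable_sq

theorem eLpNorm_two_withDensity_enorm_sq {g h : α → ℝ} (hg : AEMeasurable g m)
    (hh : AEMeasurable h (m.withDensity fun x => ‖g x‖ₑ ^ 2)) :
    eLpNorm h 2 (m.withDensity fun x => ‖g x‖ₑ ^ 2) = eLpNorm (g * h) 2 m := by
  simp only [eLpNorm_eq_lintegral_rpow_enorm_toReal two_ne_zero ENNReal.ofNat_ne_top,
    ENNReal.toReal_ofNat, ENNReal.rpow_ofNat]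
  rw [lintegral_withDensity_eq_lintegral_mul₀' (by fun_prop) (by fun_prop)]
  simp only [Pi.mul_apply, enorm_mul, mul_pow]

theorem memLp_two_withDensity_enorm_sq_iff {g h : α → ℝ} (hg : AEMeasurable g m)
    (hh : Measurable h) :
    MemLp h 2 (m.withDensity fun x => ‖g x‖ₑ ^ 2) ↔ MemLp (g * h) 2 m := by
  rw [MemLp, MemLp, eLpNorm_two_withDensity_enorm_sq hg hh.aemeasurable]
  exact and_congr_left fun _ =>
    iff_of_true hh.aestronglyMeasurable (hg.mul hh.aemeasurable).aestronglyMeasurable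

theorem tendsto_eLpNorm_mono_measure (h : m ≤ m') {f : ℕ → α → ℝ} {p : ℝ≥0∞}
    (hf : Tendsto (fun n => eLpNorm (f n) p m') atTop (𝓝 0)) :
    Tendsto (fun n => eLpNorm (f n) p m) atTop (𝓝 0) :=
  tendsto_of_tendsto_of_tendsto_of_le_of_le tendsto_const_nhds hf (fun _ => zero_le)
    fun _ => eLpNorm_mono_measure _ h

variable {K : Type*} [TopologicalSpace K] [CompactSpace K] [MeasurableSpace K] [BorelSpace K]
  (m : Measure K) [IsFiniteMeasure m]

theorem exists_continuousMap_tendsto_eLpNorm_sub [TopologicalSpace.MetrizableSpace K] {g : K → ℝ}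
    (hg : MemLp g 2 m) :
    ∃ f : ℕ → C(K, ℝ), Tendsto (fun n => eLpNorm (⇑(f n) - g) 2 m) atTop (𝓝 0) := by
  obtain ⟨ε, -, ε_mem, ε_lim⟩ := exists_seq_strictAnti_tendsto' ENNReal.zero_lt_top
  choose f hf _ using fun n =>
    hg.exists_boundedContinuous_eLpNorm_sub_le ENNReal.ofNat_ne_top (ε_mem n).1.ne'
  refine ⟨fun n => (f n).toContinuousMap, tendsto_of_tendsto_of_tendsto_of_le_of_le
    tendsto_const_nhds ε_lim (fun _ => zero_le) fun n => ?_⟩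
  rw [eLpNorm_sub_comm]
  exact hf n

end LpApproximation

section FunctionalCalculus

variable {E : Type*} [NormedAddCommGroup E] [InnerProductSpace ℂ E] [CompleteSpace E]
  {K : Type*} [TopologicalSpace K]
  (Φ : C(K, ℝ) →⋆ₐ[ℝ] (E →L[ℂ] E))

theorem inner_starAlgHom_left (f : C(K, ℝ)) (v w : E) : ⟪Φ f v, w⟫_ℂ = ⟪v, Φ f w⟫_ℂ := by
  have hf : IsSelfAdjoint (Φ f) := (IsSelfAdjoint.all f).map Φ
  rw [← ContinuousLinearMap.adjoint_inner_right, hf.adjoint_eq]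

theorem starAlgHom_mul_apply (f g : C(K, ℝ)) (v : E) : Φ (f * g) v = Φ f (Φ g v) := by
  rw [map_mul]
  rfl

theorem starAlgHom_isPositive {f : C(K, ℝ)} (hf : 0 ≤ f) : (Φ f).IsPositive := by
  rw [← ContinuousLinearMap.nonneg_iff_isPositive]
  exact map_nonneg Φ hf

variable [CompactSpace K] [TopologicalSpace.MetrizableSpace K] [MeasurableSpace K] [BorelSpace K]

/-- The positive functional `f ↦ ⟪v, Φ f v⟫`, on which the Riesz–Markov–Kakutani theorem is
applied. -/
def vectorFunctional (v : E) : CompactlySupportedContinuousMap K ℝ →ₚ[ℝ] ℝ :=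
  PositiveLinearMap.mk₀
    { toFun := fun f => (⟪v, Φ f v⟫_ℂ).re
      map_add' := fun f g => by
        have : (↑(f + g) : C(K, ℝ)) = f + g := rfl
        rw [this, map_add, add_apply, inner_add_right, Complex.add_re]
      map_smul' := fun c f => by
        have : (↑(c • f) : C(K, ℝ)) = c • (f : C(K, ℝ)) := rfl
        rw [this, map_smul, smul_apply, inner_smul_right_eq_smul,
          Complex.smul_re, RingHom.id_apply] }
    fun f hf => (starAlgHom_isPositive Φ (f := f) hf).re_inner_nonneg_right v

/-- The spectral measure on `K` of the vector `v`: it represents `f ↦ ⟪v, Φ f v⟫`. -/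
def repMeasure (v : E) : Measure K := RealRMK.rieszMeasure (vectorFunctional Φ v)

instance (v : E) : IsFiniteMeasure (repMeasure Φ v) :=
  inferInstanceAs (IsFiniteMeasure (RealRMK.rieszMeasure _))

instance (v : E) : (repMeasure Φ v).Regular :=
  inferInstanceAs (RealRMK.rieszMeasure _).Regular

theorem inner_starAlgHom_self (f : C(K, ℝ)) (v : E) :
    ⟪v, Φ f v⟫_ℂ = ((∫ x, f x ∂(repMeasure Φ v) : ℝ) : ℂ) := by
  have h : ∫ x, f x ∂(repMeasure Φ v) = (⟪v, Φ f v⟫_ℂ).re :=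
    RealRMK.integral_rieszMeasure _ (CompactlySupportedContinuousMap.continuousMapEquiv f)
  rw [h, eq_comm, ← Complex.conj_eq_iff_re, inner_conj_symm, inner_starAlgHom_left]

theorem norm_starAlgHom_apply (f : C(K, ℝ)) (v : E) :
    ‖Φ f v‖ = ‖ContinuousMap.toLp 2 (repMeasure Φ v) ℝ f‖ := by
  have h : ‖Φ f v‖ ^ 2 = ∫ x, f x * f x ∂(repMeasure Φ v) := by
    rw [← inner_self_eq_norm_sq (𝕜 := ℂ), inner_starAlgHom_left, ← starAlgHom_mul_apply,
      inner_starAlgHom_self]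
    exact Complex.ofReal_re _
  rw [← sq_eq_sq₀ (norm_nonneg _) (norm_nonneg _), h,
    ← real_inner_self_eq_norm_sq (ContinuousMap.toLp 2 _ ℝ f), ContinuousMap.inner_toLp]
  simp only [conj_trivial]

/-- The isometry `L²(m_v) → E` extending `f ↦ Φ f v`, where `m_v` is the spectral measure of `v`. -/
def cyclicMap (v : E) : Lp ℝ 2 (repMeasure Φ v) →ₗᵢ[ℝ] E where
  toLinearMap := LinearMap.extendOfNorm
    { toFun := fun f : C(K, ℝ) => Φ f v
      map_add' := fun f g => by rw [map_add, add_apply]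
      map_smul' := fun c f => by rw [map_smul, smul_apply, RingHom.id_apply] }
    (ContinuousMap.toLp 2 (repMeasure Φ v) ℝ).toLinearMap
  norm_map' g := by
    have h_dense := ContinuousMap.toLp_denseRange ℝ (repMeasure Φ v) ℝ (p := 2) (by simp)
    refine h_dense.induction_on g (isClosed_eq (by fun_prop) (by fun_prop)) fun f => ?_
    rw [← norm_starAlgHom_apply]
    congr 1
    exact LinearMap.extendOfNorm_eq h_dense ⟨1, fun f => by
      rw [one_mul]
      exact (norm_starAlgHom_apply Φ f v).le⟩ f

theorem cyclicMap_toLp (v : E) (f : C(K, ℝ)) :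
    cyclicMap Φ v (ContinuousMap.toLp 2 (repMeasure Φ v) ℝ f) = Φ f v :=
  LinearMap.extendOfNorm_eq (ContinuousMap.toLp_denseRange ℝ _ ℝ (p := 2) (by simp))
    ⟨1, fun f => by
      rw [one_mul]
      exact (norm_starAlgHom_apply Φ f v).le⟩ f

open Classical in
/-- The vector `g(Φ) v` for `g ∈ L²(m_v)`, where `m_v` is the spectral measure of `v`; the value for
other `g` is `0`. -/
def applyFun (v : E) (g : K → ℝ) : E :=
  if hg : MemLp g 2 (repMeasure Φ v) then cyclicMap Φ v (hg.toLp g) else 0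

theorem memLp_continuousMap (f : C(K, ℝ)) (v : E) (p : ℝ≥0∞) : MemLp f p (repMeasure Φ v) :=
  MemLp.of_bound f.continuous.aestronglyMeasurable ‖f‖ (.of_forall f.norm_coe_le_norm)

theorem applyFun_continuousMap (f : C(K, ℝ)) (v : E) : applyFun Φ v f = Φ f v := by
  rw [applyFun, dif_pos (memLp_continuousMap Φ f v 2), ← cyclicMap_toLp]
  rfl

variable {Φ} {v w : E} {g h : K → ℝ}

theorem applyFun_of_memLp (hg : MemLp g 2 (repMeasure Φ v)) :
    applyFun Φ v g = cyclicMap Φ v (hg.toLp g) := dif_pos hg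

theorem applyFun_congr_ae (hg : MemLp g 2 (repMeasure Φ v)) (hgh : g =ᵐ[repMeasure Φ v] h) :
    applyFun Φ v g = applyFun Φ v h := by
  rw [applyFun_of_memLp hg, applyFun_of_memLp (hg.ae_eq hgh), MemLp.toLp_congr _ _ hgh]

theorem applyFun_add (hg : MemLp g 2 (repMeasure Φ v)) (hh : MemLp h 2 (repMeasure Φ v)) :
    applyFun Φ v (g + h) = applyFun Φ v g + applyFun Φ v h := by
  rw [applyFun_of_memLp hg, applyFun_of_memLp hh, applyFun_of_memLp (hg.add hh), MemLp.toLp_add,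
    map_add]

theorem re_inner_applyFun (hg : MemLp g 2 (repMeasure Φ v)) (hh : MemLp h 2 (repMeasure Φ v)) :
    (⟪applyFun Φ v g, applyFun Φ v h⟫_ℂ).re = ∫ x, g x * h x ∂(repMeasure Φ v) := by
  let _ : InnerProductSpace ℝ E := InnerProductSpace.complexToReal
  rw [applyFun_of_memLp hg, applyFun_of_memLp hh]
  refine ((cyclicMap Φ v).inner_map_map (hg.toLp g) (hh.toLp h)).trans ?_
  rw [L2.inner_def]
  refine integral_congr_ae ?_
  filter_upwards [hg.coeFn_toLp, hh.coeFn_toLp] with x hgx hhx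
  rw [hgx, hhx, real_inner_comm]
  rfl

theorem tendsto_applyFun (hg : MemLp g 2 (repMeasure Φ v)) {f : ℕ → K → ℝ}
    (hf : ∀ n, MemLp (f n) 2 (repMeasure Φ v))
    (h_lim : Tendsto (fun n => eLpNorm (f n - g) 2 (repMeasure Φ v)) atTop (𝓝 0)) :
    Tendsto (fun n => applyFun Φ v (f n)) atTop (𝓝 (applyFun Φ v g)) := by
  simp only [applyFun_of_memLp, hg, hf]
  exact ((cyclicMap Φ v).continuous.tendsto _).comp
    ((Lp.tendsto_Lp_iff_tendsto_eLpNorm'' f hf g hg).2 h_lim)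

theorem tendsto_starAlgHom_apply (hg : MemLp g 2 (repMeasure Φ v)) {f : ℕ → C(K, ℝ)}
    (h_lim : Tendsto (fun n => eLpNorm (⇑(f n) - g) 2 (repMeasure Φ v)) atTop (𝓝 0)) :
    Tendsto (fun n => Φ (f n) v) atTop (𝓝 (applyFun Φ v g)) := by
  simpa only [applyFun_continuousMap] using
    tendsto_applyFun hg (fun n => memLp_continuousMap Φ (f n) v 2) h_lim

theorem inner_applyFun_left (hg : MemLp g 2 (repMeasure Φ v)) (hg' : MemLp g 2 (repMeasure Φ w)) :
    ⟪applyFun Φ v g, w⟫_ℂ = ⟪v, applyFun Φ w g⟫_ℂ := by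
  obtain ⟨f, hf⟩ := exists_continuousMap_tendsto_eLpNorm_sub _ (memLp_two_add_measure hg hg')
  have hv := tendsto_starAlgHom_apply hg
    (tendsto_eLpNorm_mono_measure (Measure.le_add_right le_rfl) hf)
  have hw := tendsto_starAlgHom_apply hg'
    (tendsto_eLpNorm_mono_measure (Measure.le_add_left le_rfl) hf)
  exact tendsto_nhds_unique (hv.inner tendsto_const_nhds)
    ((tendsto_const_nhds.inner hw).congr fun n => (inner_starAlgHom_left Φ _ _ _).symm)

theorem memLp_continuousMap_mul (f : C(K, ℝ)) (hg : MemLp g 2 (repMeasure Φ v)) :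
    MemLp (⇑f * g) 2 (repMeasure Φ v) :=
  hg.mul (memLp_continuousMap Φ f v ∞)

theorem starAlgHom_applyFun (f : C(K, ℝ)) (hg : MemLp g 2 (repMeasure Φ v)) :
    Φ f (applyFun Φ v g) = applyFun Φ v (⇑f * g) := by
  obtain ⟨u, hu⟩ := exists_continuousMap_tendsto_eLpNorm_sub _ hg
  have hfu : Tendsto (fun n => eLpNorm (⇑(f * u n) - ⇑f * g) 2 (repMeasure Φ v)) atTop (𝓝 0) := by
    simpa only [mul_sub, ContinuousMap.coe_mul] using
      tendsto_eLpNorm_mul_of_bound hu f.norm_coe_le_norm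
  refine tendsto_nhds_unique (((Φ f).continuous.tendsto _).comp (tendsto_starAlgHom_apply hg hu))
    ((tendsto_starAlgHom_apply (memLp_continuousMap_mul f hg) hfu).congr fun n => ?_)
  exact starAlgHom_mul_apply Φ f (u n) v

theorem repMeasure_applyFun (hg : MemLp g 2 (repMeasure Φ v)) :
    repMeasure Φ (applyFun Φ v g) = (repMeasure Φ v).withDensity fun x => ‖g x‖ₑ ^ 2 := by
  have h_fin : ∫⁻ x, ‖g x‖ₑ ^ 2 ∂(repMeasure Φ v) < ∞ := by
    simpa using lintegral_rpow_enorm_lt_top_of_eLpNorm_lt_top two_ne_zero ENNReal.ofNat_ne_top hg.2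
  have := isFiniteMeasure_withDensity h_fin.ne
  have hg_meas : AEMeasurable (fun x => ‖g x‖ₑ ^ 2) (repMeasure Φ v) := by
    have := hg.1
    fun_prop
  refine ext_of_forall_integral_eq_of_IsFiniteMeasure fun f => ?_
  have h_self := inner_starAlgHom_self Φ f.toContinuousMap (applyFun Φ v g)
  rw [starAlgHom_applyFun _ hg, Complex.ext_iff, re_inner_applyFun hg
    (memLp_continuousMap_mul _ hg), Complex.ofReal_re] at h_self
  rw [integral_withDensity_eq_integral_toReal_smul₀ hg_meas (.of_forall fun x => by simp)]
  refine h_self.1.symm.trans (integral_congr_ae (.of_forall fun x => ?_))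
  simp
  ring

theorem applyFun_applyFun (hg : MemLp g 2 (repMeasure Φ v)) (hh : Measurable h)
    (hgh : MemLp (g * h) 2 (repMeasure Φ v)) :
    applyFun Φ (applyFun Φ v g) h = applyFun Φ v (g * h) := by
  have hh_memLp : MemLp h 2 (repMeasure Φ (applyFun Φ v g)) := by
    rwa [repMeasure_applyFun hg, memLp_two_withDensity_enorm_sq_iff hg.1.aemeasurable hh]
  obtain ⟨u, hu⟩ := exists_continuousMap_tendsto_eLpNorm_sub _ hh_memLp
  have hu' : Tendsto (fun n => eLpNorm (⇑(u n) * g - g * h) 2 (repMeasure Φ v)) atTop (𝓝 0) := by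
    refine hu.congr fun n => ?_
    rw [repMeasure_applyFun hg, eLpNorm_two_withDensity_enorm_sq hg.1.aemeasurable (by fun_prop),
      mul_sub, mul_comm g (u n)]
  refine tendsto_nhds_unique (tendsto_starAlgHom_apply hh_memLp hu)
    ((tendsto_applyFun hgh (fun n => memLp_continuousMap_mul (u n) hg) hu').congr fun n => ?_)
  exact (starAlgHom_applyFun (u n) hg).symm

end FunctionalCalculus

section SpectralProjections

variable {E : Type*} [NormedAddCommGroup E] [InnerProductSpace ℂ E] [CompleteSpace E]
  {K : Type*} [TopologicalSpace K] [CompactSpace K] [TopologicalSpace.MetrizableSpace K]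
  [MeasurableSpace K] [BorelSpace K] (Φ : C(K, ℝ) →⋆ₐ[ℝ] (E →L[ℂ] E)) {S T : Set K}

theorem inner_applyFun_indicator_left (hS : MeasurableSet S) (v w : E) :
    ⟪applyFun Φ v (S.indicator 1), w⟫_ℂ = ⟪v, applyFun Φ w (S.indicator 1)⟫_ℂ :=
  inner_applyFun_left (memLp_indicator_one hS 2) (memLp_indicator_one hS 2)

open Classical in
/-- The spectral projection `1_S(Φ)`; the value on non-measurable sets is `0`. -/
def indicatorOp (S : Set K) : E →L[ℂ] E :=
  if hS : MeasurableSet S then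
    LinearMap.IsSymmetric.toSelfAdjoint
      (T := { toFun := fun v => applyFun Φ v (S.indicator 1)
              map_add' := fun v w => ext_inner_right ℂ fun u => by
                simp only [inner_add_left, inner_applyFun_indicator_left Φ hS]
              map_smul' := fun c v => ext_inner_right ℂ fun u => by
                simp only [inner_smul_left, inner_applyFun_indicator_left Φ hS, RingHom.id_apply] })
      (inner_applyFun_indicator_left Φ hS)
  else 0

variable {Φ}

theorem indicatorOp_apply (hS : MeasurableSet S) (v : E) :
    indicatorOp Φ S v = applyFun Φ v (S.indicator 1) := by
  rw [indicatorOp, dif_pos hS]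
  rfl

theorem indicatorOp_univ : indicatorOp Φ univ = 1 := by
  ext v
  rw [indicatorOp_apply .univ, indicator_univ, ← ContinuousMap.coe_one, applyFun_continuousMap,
    map_one]

theorem indicatorOp_inter (hS : MeasurableSet S) (hT : MeasurableSet T) :
    indicatorOp Φ (S ∩ T) = indicatorOp Φ S ∘L indicatorOp Φ T := by
  ext v
  have h_inter : T.indicator 1 * S.indicator 1 = (S ∩ T).indicator (1 : K → ℝ) := by
    rw [← inter_indicator_one, inter_comm]
  rw [ContinuousLinearMap.comp_apply, indicatorOp_apply hS, indicatorOp_apply hT,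
    indicatorOp_apply (hS.inter hT), applyFun_applyFun (memLp_indicator_one hT 2)
    (measurable_one.indicator hS), h_inter]
  rw [h_inter]
  exact memLp_indicator_one (hS.inter hT) 2

theorem isStarProjection_indicatorOp (hS : MeasurableSet S) :
    IsStarProjection (indicatorOp Φ S) := by
  refine ⟨?_, ?_⟩
  · have h := indicatorOp_inter (Φ := Φ) hS hS
    rw [inter_self] at h
    exact h.symm
  · rw [indicatorOp, dif_pos hS]
    exact Subtype.prop _

theorem norm_sq_indicatorOp (hS : MeasurableSet S) (v : E) :
    ‖indicatorOp Φ S v‖ ^ 2 = (repMeasure Φ v).real S := by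
  have hS_memLp := memLp_indicator_one (m := repMeasure Φ v) hS 2
  rw [indicatorOp_apply hS, ← inner_self_eq_norm_sq (𝕜 := ℂ), ← integral_indicator_one hS]
  refine (re_inner_applyFun hS_memLp hS_memLp).trans (integral_congr_ae (.of_forall fun x => ?_))
  by_cases hx : x ∈ S <;> simp [hx]

theorem indicatorOp_union (hS : MeasurableSet S) (hT : MeasurableSet T) (h : Disjoint S T) :
    indicatorOp Φ (S ∪ T) = indicatorOp Φ S + indicatorOp Φ T := by
  ext v
  rw [add_apply, indicatorOp_apply hS, indicatorOp_apply hT, indicatorOp_apply (hS.union hT),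
    indicator_union_of_disjoint h, ← applyFun_add (memLp_indicator_one hS 2)
    (memLp_indicator_one hT 2)]
  rfl

theorem indicatorOp_biUnion {S : ℕ → Set K} (hS : ∀ n, MeasurableSet (S n))
    (hd : Pairwise (Function.onFun Disjoint S)) (s : Finset ℕ) :
    indicatorOp Φ (⋃ n ∈ s, S n) = ∑ n ∈ s, indicatorOp Φ (S n) := by
  classical
  induction s using Finset.induction_on with
  | empty =>
    ext v
    have h := norm_sq_indicatorOp (Φ := Φ) .empty v
    simpa using h
  | insert a s ha ih =>
    have h_disj : Disjoint (S a) (⋃ n ∈ s, S n) :=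
      disjoint_iUnion₂_right.2 fun n hn => hd fun h => ha (h ▸ hn)
    rw [Finset.sum_insert ha, ← ih, Finset.set_biUnion_insert,
      indicatorOp_union (hS a) (s.measurableSet_biUnion fun n _ => hS n) h_disj]

theorem hasSum_indicatorOp {S : ℕ → Set K} (hS : ∀ n, MeasurableSet (S n))
    (hd : Pairwise (Function.onFun Disjoint S)) (v : E) :
    HasSum (fun n => indicatorOp Φ (S n) v) (indicatorOp Φ (⋃ n, S n) v) := by
  let tail (s : Finset ℕ) : Set K := (⋃ n, S n) \ ⋃ n ∈ s, S n
  have h_meas (s : Finset ℕ) : MeasurableSet (⋃ n ∈ s, S n) :=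
    s.measurableSet_biUnion fun n _ => hS n
  have h_tail_meas (s : Finset ℕ) : MeasurableSet (tail s) :=
    (MeasurableSet.iUnion hS).diff (h_meas s)
  have h_tail : Tendsto (fun s => (repMeasure Φ v).real (tail s)) atTop (𝓝 0) := by
    have h_anti : Antitone tail := fun s t hst =>
      sdiff_subset_sdiff_right (biUnion_subset_biUnion_left hst)
    have h_empty : ⋂ s, tail s = ∅ := by
      rw [← sdiff_iUnion, sdiff_eq_empty]
      exact iUnion_subset fun n => (subset_biUnion_of_mem (Finset.mem_singleton_self n)).trans
        (subset_iUnion (fun s : Finset ℕ => ⋃ n ∈ s, S n) {n})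
    have := tendsto_measure_iInter_atTop (μ := repMeasure Φ v)
      (fun s => (h_tail_meas s).nullMeasurableSet) h_anti ⟨∅, measure_ne_top _ _⟩
    rw [h_empty, measure_empty] at this
    exact (ENNReal.tendsto_toReal ENNReal.zero_ne_top).comp this
  have h_diff (s : Finset ℕ) : ‖∑ n ∈ s, indicatorOp Φ (S n) v - indicatorOp Φ (⋃ n, S n) v‖ =
      √((repMeasure Φ v).real (tail s)) := by
    have h_split : indicatorOp Φ (⋃ n, S n) =
        ∑ n ∈ s, indicatorOp Φ (S n) + indicatorOp Φ (tail s) := by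
      rw [← indicatorOp_biUnion hS hd, ← indicatorOp_union (h_meas s) (h_tail_meas s)
        disjoint_sdiff_right, union_sdiff_cancel (iUnion₂_subset fun n _ => subset_iUnion S n)]
    rw [h_split, add_apply, sum_apply, sub_add_cancel_left, norm_neg,
      ← norm_sq_indicatorOp (h_tail_meas s), Real.sqrt_sq (norm_nonneg _)]
  rw [HasSum, SummationFilter.unconditional_filter, tendsto_iff_norm_sub_tendsto_zero]
  simpa only [h_diff, Real.sqrt_zero] using h_tail.sqrt

end SpectralProjections

section Resolvent

variable {E : Type*} [NormedAddCommGroup E] [InnerProductSpace ℂ E] {A : E →ₗ.[ℂ] E} {v w : E}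

theorem norm_le_norm_add_of_mem_graph (hA_pos : ∀ v : A.domain, 0 ≤ (⟪(v : E), A v⟫_ℂ).re)
    (h : (v, w) ∈ A.graph) : ‖v‖ ≤ ‖v + w‖ := by
  obtain ⟨v, rfl, rfl⟩ := A.mem_graph_iff.1 h
  have h_sq : ‖(v : E)‖ ^ 2 ≤ ‖(v : E)‖ * ‖(v : E) + A v‖ := calc
    ‖(v : E)‖ ^ 2 ≤ ‖(v : E)‖ ^ 2 + (⟪(v : E), A v⟫_ℂ).re := le_add_of_nonneg_right (hA_pos v)
    _ = (⟪(v : E), v + A v⟫_ℂ).re := by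
      rw [inner_add_right, Complex.add_re, ← inner_self_eq_norm_sq (𝕜 := ℂ)]
      rfl
    _ ≤ ‖(v : E)‖ * ‖(v : E) + A v‖ := (Complex.re_le_norm _).trans (norm_inner_le_norm _ _)
  by_contra! h_lt
  nlinarith [norm_nonneg ((v : E) + A v)]

variable (A) in
/-- The map `1 + A`, considered on the graph of `A` in order to be bounded. -/
def graphOneAdd : A.graph →L[ℂ] E :=
  (ContinuousLinearMap.fst ℂ E E + ContinuousLinearMap.snd ℂ E E) ∘L A.graph.subtypeL

theorem norm_le_two_mul_norm_graphOneAdd (hA_pos : ∀ v : A.domain, 0 ≤ (⟪(v : E), A v⟫_ℂ).re)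
    (x : A.graph) : ‖x‖ ≤ 2 * ‖graphOneAdd A x‖ := by
  obtain ⟨⟨v, w⟩, hx⟩ := x
  have hv : ‖v‖ ≤ ‖v + w‖ := norm_le_norm_add_of_mem_graph hA_pos hx
  have hw : ‖w‖ ≤ ‖v + w‖ + ‖v‖ := by simpa using norm_sub_le (v + w) v
  exact max_le (by simpa [graphOneAdd] using by linarith [norm_nonneg (v + w)])
    (by simpa [graphOneAdd] using by linarith)

variable [CompleteSpace E]

theorem mem_graph_iff_of_isSelfAdjoint (hA : IsSelfAdjoint A) :
    (v, w) ∈ A.graph ↔ ∀ a b, (a, b) ∈ A.graph → ⟪b, v⟫_ℂ = ⟪a, w⟫_ℂ := by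
  conv_lhs => rw [← LinearPMap.isSelfAdjoint_def.1 hA,
    LinearPMap.adjoint_graph_eq_graph_adjoint hA.dense_domain, Submodule.mem_adjoint_iff]
  simp only [sub_eq_zero]

theorem range_graphOneAdd (hA : IsSelfAdjoint A)
    (hA_pos : ∀ v : A.domain, 0 ≤ (⟪(v : E), A v⟫_ℂ).re) :
    (graphOneAdd A).range = ⊤ := by
  have h_complete : CompleteSpace A.graph := hA.isClosed.completeSpace_coe
  have h_anti := (graphOneAdd A).antilipschitz_of_bound (K := 2)
    (norm_le_two_mul_norm_graphOneAdd hA_pos)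
  have h_closed := h_anti.isClosed_range (graphOneAdd A).uniformContinuous
  have : CompleteSpace (graphOneAdd A).range := h_closed.completeSpace_coe
  rw [← Submodule.orthogonal_eq_bot_iff, Submodule.eq_bot_iff]
  intro w hw
  have h_mem : (w, -w) ∈ A.graph := by
    refine (mem_graph_iff_of_isSelfAdjoint hA).2 fun a b hab => ?_
    have := Submodule.inner_right_of_mem_orthogonal (LinearMap.mem_range_self _ ⟨(a, b), hab⟩) hw
    rw [inner_neg_right, eq_neg_iff_add_eq_zero, add_comm, ← inner_add_left]
    exact this
  simpa using norm_le_norm_add_of_mem_graph hA_pos h_mem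

theorem exists_resolvent (hA : IsSelfAdjoint A)
    (hA_pos : ∀ v : A.domain, 0 ≤ (⟪(v : E), A v⟫_ℂ).re) :
    ∃ R : E →L[ℂ] E, IsSelfAdjoint R ∧ ∀ v w, (v, w) ∈ A.graph ↔ R (v + w) = v := by
  have h_complete : CompleteSpace A.graph := hA.isClosed.completeSpace_coe
  have h_anti := (graphOneAdd A).antilipschitz_of_bound (K := 2)
    (norm_le_two_mul_norm_graphOneAdd hA_pos)
  let e := ContinuousLinearEquiv.ofBijective (graphOneAdd A)
    (LinearMap.ker_eq_bot.2 h_anti.injective) (range_graphOneAdd hA hA_pos)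
  have he (y : E) : (e.symm y : E × E).1 + (e.symm y : E × E).2 = y := e.apply_symm_apply y
  refine ⟨ContinuousLinearMap.fst ℂ E E ∘L A.graph.subtypeL ∘L e.symm, ?_, fun v w => ⟨?_, ?_⟩⟩
  · rw [ContinuousLinearMap.isSelfAdjoint_iff_isSymmetric]
    intro y z
    change ⟪(e.symm y : E × E).1, z⟫_ℂ = ⟪y, (e.symm z : E × E).1⟫_ℂ
    have h_symm := (mem_graph_iff_of_isSelfAdjoint hA).1 (e.symm z).2 _ _ (e.symm y).2
    conv_lhs => rw [← he z, inner_add_right, ← h_symm]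
    conv_rhs => rw [← he y, inner_add_left]
  · intro h
    exact congrArg (fun x : A.graph => (x : E × E).1) (e.symm_apply_apply ⟨(v, w), h⟩)
  · intro h
    change (e.symm (v + w) : E × E).1 = v at h
    have h_snd := he (v + w)
    rw [h, add_right_inj] at h_snd
    have h_eq : (e.symm (v + w) : E × E) = (v, w) := Prod.ext h h_snd
    exact h_eq ▸ (e.symm (v + w)).2

end Resolvent

section SpectralTheorem

variable {E : Type*} [NormedAddCommGroup E] [InnerProductSpace ℂ E] [CompleteSpace E]

theorem inner_starProjection_apply {p : E →L[ℂ] E} (hp : IsStarProjection p) (v : E) :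
    ⟪v, p v⟫_ℂ = ((‖p v‖ ^ 2 : ℝ) : ℂ) := by
  have h : p v = p (p v) := congrArg (· v) hp.isIdempotentElem.eq.symm
  rw [h, ← ContinuousLinearMap.adjoint_inner_left, hp.isSelfAdjoint.adjoint_eq, ← h,
    inner_self_eq_norm_sq_to_K]
  norm_cast

theorem ProjectionValuedMeasure.scalar_apply (P : ProjectionValuedMeasure E) (v : E) {S : Set ℝ}
    (hS : MeasurableSet S) : P.scalar v S = ENNReal.ofReal (‖P.proj S v‖ ^ 2) := by
  rw [scalar, Measure.ofMeasurable_apply S hS,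
    inner_starProjection_apply (P.isStarProjection S hS), Complex.ofReal_re]

variable {K : Type*} [TopologicalSpace K] [CompactSpace K] [TopologicalSpace.MetrizableSpace K]
  [MeasurableSpace K] [BorelSpace K] (Φ : C(K, ℝ) →⋆ₐ[ℝ] (E →L[ℂ] E))

/-- The projection-valued measure `S ↦ 1_S(φ(Φ))`, for a Borel function `φ`. -/
def pvmOfStarAlgHom (φ : K → ℝ) (hφ : Measurable φ) : ProjectionValuedMeasure E where
  proj S := indicatorOp Φ (φ ⁻¹' S)
  isStarProjection _ hS := isStarProjection_indicatorOp (hφ hS)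
  univ := indicatorOp_univ
  inter _ _ hS hT := indicatorOp_inter (hφ hS) (hφ hT)
  iUnion S hS hd v := by
    rw [preimage_iUnion]
    exact hasSum_indicatorOp (fun n => hφ (hS n)) (fun _ _ h => (hd h).preimage φ) v

theorem scalar_pvmOfStarAlgHom {φ : K → ℝ} (hφ : Measurable φ) (v : E) :
    (pvmOfStarAlgHom Φ φ hφ).scalar v = (repMeasure Φ v).map φ := by
  ext S hS
  rw [ProjectionValuedMeasure.scalar_apply _ _ hS, Measure.map_apply hφ hS,
    ← ofReal_measureReal, ← norm_sq_indicatorOp (hφ hS)]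
  rfl

variable {Φ} {r : C(K, ℝ)}

theorem ae_ne_zero_of_injective (hr : Function.Injective (Φ r)) (v : E) :
    ∀ᵐ x ∂(repMeasure Φ v), r x ≠ 0 := by
  have h_meas : MeasurableSet {x | r x = 0} := measurableSet_eq_fun (by fun_prop) (by fun_prop)
  have h_mul : ⇑r * {x | r x = 0}.indicator 1 = ⇑(0 : C(K, ℝ)) := by
    ext x
    by_cases hx : r x = 0 <;> simp [hx]
  have h_zero : indicatorOp Φ {x | r x = 0} v = 0 := hr <| by
    rw [indicatorOp_apply h_meas, starAlgHom_applyFun r (memLp_indicator_one h_meas 2), h_mul,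
      applyFun_continuousMap, map_zero, map_zero, zero_apply]
  have h_norm := norm_sq_indicatorOp (Φ := Φ) h_meas v
  rw [h_zero, norm_zero, zero_pow two_ne_zero, eq_comm, measureReal_eq_zero_iff] at h_norm
  simpa only [ae_iff, not_not] using h_norm

theorem mem_range_iff_memLp_inv (hr : Function.Injective (Φ r)) (v : E) :
    v ∈ range (Φ r) ↔ MemLp (fun x => (r x)⁻¹) 2 (repMeasure Φ v) := by
  have h_inv (v : E) : ⇑r * (fun x => (r x)⁻¹) =ᵐ[repMeasure Φ v] ⇑(1 : C(K, ℝ)) := by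
    filter_upwards [ae_ne_zero_of_injective hr v] with x hx
    exact mul_inv_cancel₀ hx
  constructor
  · rintro ⟨u, rfl⟩
    rw [← applyFun_continuousMap, repMeasure_applyFun (memLp_continuousMap Φ r u 2),
      memLp_two_withDensity_enorm_sq_iff (by fun_prop) (by fun_prop), memLp_congr_ae (h_inv u)]
    exact memLp_continuousMap Φ 1 u 2
  · intro h
    refine ⟨applyFun Φ v fun x => (r x)⁻¹, ?_⟩
    rw [starAlgHom_applyFun r h, applyFun_congr_ae (memLp_continuousMap_mul r h) (h_inv v),
      applyFun_continuousMap, map_one]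
    rfl

theorem integral_repMeasure_starAlgHom_apply (v : E) (g : K → ℝ) :
    ∫ x, g x ∂(repMeasure Φ (Φ r v)) = ∫ x, r x ^ 2 * g x ∂(repMeasure Φ v) := by
  rw [← applyFun_continuousMap, repMeasure_applyFun (memLp_continuousMap Φ r v 2),
    integral_withDensity_eq_integral_toReal_smul (by fun_prop) (.of_forall fun x => by simp)]
  simp

variable {A : E →ₗ.[ℂ] E}

/- As `Φ r = (1 + A)⁻¹`, the operator `A` is `r⁻¹ - 1`. -/
theorem isSpectralMeasure_of_resolvent
    (h : ∀ v w, (v, w) ∈ A.graph ↔ Φ r (v + w) = v) :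
    IsSpectralMeasure A (pvmOfStarAlgHom Φ (fun x => (r x)⁻¹ - 1) (by fun_prop)) := by
  have h_inj : Function.Injective (Φ r) := (injective_iff_map_eq_zero _).2 fun y hy =>
    A.graph_fst_eq_zero_snd ((h 0 y).2 (by rwa [zero_add])) rfl
  refine ⟨fun v => ?_, fun ⟨v, hv⟩ => ?_⟩
  · have h_dom : v ∈ A.domain ↔ v ∈ range (Φ r) := by
      rw [LinearPMap.mem_domain_iff]
      exact ⟨fun ⟨w, hw⟩ => ⟨_, (h v w).1 hw⟩, fun ⟨y, hy⟩ => ⟨y - v, (h v _).2 (by simpa)⟩⟩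
    have h_sub : MemLp (fun x => (r x)⁻¹) 2 (repMeasure Φ v) ↔
        MemLp (fun x => (r x)⁻¹ - 1) 2 (repMeasure Φ v) :=
      ⟨fun h => h.sub (memLp_const 1), fun h => by
        simpa only [Pi.add_def, sub_add_cancel] using h.add (memLp_const 1)⟩
    rw [h_dom, mem_range_iff_memLp_inv h_inj, h_sub, memLp_two_iff_integrable_sq (by fun_prop),
      Integrable, hasFiniteIntegral_iff_ofReal (.of_forall fun x => sq_nonneg _),
      scalar_pvmOfStarAlgHom, lintegral_map (by fun_prop) (by fun_prop)]
    exact and_iff_right (by fun_prop)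
  · obtain ⟨w, hw⟩ := LinearPMap.mem_domain_iff.1 hv
    obtain ⟨y, rfl⟩ : ∃ y, Φ r y = v := ⟨_, (h v w).1 hw⟩
    have h_apply : A ⟨Φ r y, hv⟩ = y - Φ r y :=
      ((LinearPMap.image_iff hv).2 ((h _ _).2 (by rw [add_sub_cancel]))).symm
    have h_inner : ⟪Φ r y, y - Φ r y⟫_ℂ = ⟪y, Φ (r - r * r) y⟫_ℂ := by
      rw [inner_starAlgHom_left, map_sub, map_sub, ← starAlgHom_mul_apply, sub_apply]
    rw [h_apply, h_inner, inner_starAlgHom_self, scalar_pvmOfStarAlgHom,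
      integral_map (by fun_prop) (by fun_prop), integral_repMeasure_starAlgHom_apply]
    congr 2 with x
    by_cases hx : r x = 0
    · simp [hx]
    · simp only [ContinuousMap.sub_apply, ContinuousMap.mul_apply]
      field_simp

theorem exists_isSpectralMeasure (hA : IsSelfAdjoint A)
    (hA_pos : ∀ v : A.domain, 0 ≤ (⟪(v : E), A v⟫_ℂ).re) :
    ∃ P, IsSpectralMeasure A P := by
  obtain ⟨R, hR, h⟩ := exists_resolvent hA hA_pos
  have h_id : cfcHom hR ((ContinuousMap.id ℝ).restrict (spectrum ℝ R)) = R := cfcHom_id hR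
  exact ⟨_, isSpectralMeasure_of_resolvent (Φ := cfcHom hR) (h_id ▸ h)⟩

theorem isSpectralMeasure_spectralMeasure (hA : IsSelfAdjoint A)
    (hA_pos : ∀ v : A.domain, 0 ≤ (⟪(v : E), A v⟫_ℂ).re) :
    IsSpectralMeasure A (spectralMeasure A) :=
  Classical.epsilon_spec (exists_isSpectralMeasure hA hA_pos)

end SpectralTheorem

section SquareRoot

variable {E : Type*} [NormedAddCommGroup E] [InnerProductSpace ℂ E] [CompleteSpace E]
  {T : E →L[ℂ] E}

variable (T) in
theorem isSelfAdjoint_opSqrt : IsSelfAdjoint (opSqrt T) := (CFC.sqrt_nonneg T).isSelfAdjoint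

theorem opSqrt_mul_opSqrt (hT : T.IsPositive) : opSqrt T * opSqrt T = T :=
  CFC.sqrt_mul_sqrt_self T (T.nonneg_iff_isPositive.2 hT)

theorem norm_sq_opSqrt_apply (hT : T.IsPositive) (v : E) :
    ‖opSqrt T v‖ ^ 2 = (⟪v, T v⟫_ℂ).re := by
  have h_apply : T v = opSqrt T (opSqrt T v) := congrArg (· v) (opSqrt_mul_opSqrt hT).symm
  rw [h_apply, inner_opSqrt_right]
  exact (inner_self_eq_norm_sq (𝕜 := ℂ) _).symm

end SquareRoot

section SpectralMeasure

variable {E : Type*} [NormedAddCommGroup E] [InnerProductSpace ℂ E] [CompleteSpace E]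

namespace ProjectionValuedMeasure

variable (P : ProjectionValuedMeasure E) {S T : Set ℝ}

instance (v : E) : IsFiniteMeasure (P.scalar v) :=
  ⟨by rw [P.scalar_apply v .univ]; exact ENNReal.ofReal_lt_top⟩

theorem norm_sq_proj (hS : MeasurableSet S) (v : E) : ‖P.proj S v‖ ^ 2 = (P.scalar v).real S := by
  rw [measureReal_def, P.scalar_apply v hS, ENNReal.toReal_ofReal (sq_nonneg _)]

theorem scalar_proj (hS : MeasurableSet S) (v : E) :
    P.scalar (P.proj S v) = (P.scalar v).restrict S := by
  ext T hT
  rw [Measure.restrict_apply hT, P.scalar_apply _ hT, P.scalar_apply _ (hT.inter hS),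
    P.inter T S hT hS, ContinuousLinearMap.comp_apply]

theorem proj_union (hS : MeasurableSet S) (hT : MeasurableSet T) (h : Disjoint S T) :
    P.proj (S ∪ T) = P.proj S + P.proj T := by
  refine ContinuousLinearMap.coe_injective ((ext_inner_map _ _).1 fun v => ?_)
  rw [← inner_conj_symm, ← inner_conj_symm (((P.proj S + P.proj T : E →L[ℂ] E) : E →ₗ[ℂ] E) v)]
  simp only [ContinuousLinearMap.coe_coe, add_apply, inner_add_right]
  rw [inner_starProjection_apply (P.isStarProjection _ hS),
    inner_starProjection_apply (P.isStarProjection _ hT),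
    inner_starProjection_apply (P.isStarProjection _ (hS.union hT)), P.norm_sq_proj hS,
    P.norm_sq_proj hT, P.norm_sq_proj (hS.union hT), measureReal_union h hT, Complex.ofReal_add]

theorem one_sub_proj_comp (hS : MeasurableSet S) (hT : MeasurableSet T) (h : Disjoint S T)
    {L : E →L[ℂ] E} (hL : P.proj (S ∪ T)ᶜ ∘L L = 0) :
    (1 - P.proj S) ∘L L = P.proj T ∘L L := by
  have h_one : 1 = P.proj S + P.proj T + P.proj (S ∪ T)ᶜ := by
    rw [← P.proj_union hS hT h, ← P.proj_union (hS.union hT) (hS.union hT).compl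
      disjoint_compl_right, union_compl_self, P.univ]
  rw [h_one, add_assoc, add_sub_cancel_left, ContinuousLinearMap.add_comp, hL, add_zero]

end ProjectionValuedMeasure

variable {A : E →ₗ.[ℂ] E} {P : ProjectionValuedMeasure E} {S : Set ℝ}

theorem apply_eq_zero_of_inner_apply_eq_zero (hA : IsSelfAdjoint A)
    (hA_pos : ∀ v : A.domain, 0 ≤ (⟪(v : E), A v⟫_ℂ).re) {w : A.domain}
    (hw : ⟪(w : E), A w⟫_ℂ = 0) : A w = 0 := by
  let form : PreInnerProductSpace.Core ℂ A.domain :=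
    { inner u w := ⟪(u : E), A w⟫_ℂ
      conj_inner_symm u w := by
        rw [inner_conj_symm]
        exact (mem_graph_iff_of_isSelfAdjoint hA).1 (A.mem_graph w) _ _ (A.mem_graph u)
      re_inner_nonneg := hA_pos
      add_left u v w := inner_add_left _ _ _
      smul_left u v c := inner_smul_left _ _ _ }
  refine hA.dense_domain.eq_zero_of_inner_right ℂ fun u hu => ?_
  have h_cauchy : ‖⟪u, A w⟫_ℂ‖ * ‖⟪(w : E), A ⟨u, hu⟩⟫_ℂ‖ ≤
      (⟪u, A ⟨u, hu⟩⟫_ℂ).re * (⟪(w : E), A w⟫_ℂ).re :=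
    InnerProductSpace.Core.inner_mul_inner_self_le (c := form) ⟨u, hu⟩ w
  have h_symm : ‖⟪(w : E), A ⟨u, hu⟩⟫_ℂ‖ = ‖⟪u, A w⟫_ℂ‖ := by
    rw [← (mem_graph_iff_of_isSelfAdjoint hA).1 (A.mem_graph ⟨u, hu⟩) _ _ (A.mem_graph w),
      norm_inner_symm]
  rw [hw, Complex.zero_re, mul_zero, h_symm] at h_cauchy
  exact norm_eq_zero.1 (mul_self_eq_zero.1 (le_antisymm h_cauchy (mul_self_nonneg _)))

namespace IsSpectralMeasure

theorem proj_mem_domain (hP : IsSpectralMeasure A P) (hS : MeasurableSet S)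
    (hS_bdd : Bornology.IsBounded S) (v : E) : P.proj S v ∈ A.domain := by
  obtain ⟨C, hC⟩ := hS_bdd.exists_norm_le
  rw [hP.1, P.scalar_proj hS]
  refine setLIntegral_lt_top_of_le_nnreal (measure_ne_top _ _) ⟨(C ^ 2).toNNReal, fun t ht => ?_⟩
  exact ENNReal.ofReal_le_ofReal (sq_le_sq' (abs_le.1 (hC t ht)).1 (abs_le.1 (hC t ht)).2)

theorem inner_apply_proj (hP : IsSpectralMeasure A P) (hS : MeasurableSet S)
    (hS_bdd : Bornology.IsBounded S) (v : E) :
    ⟪P.proj S v, A ⟨P.proj S v, hP.proj_mem_domain hS hS_bdd v⟩⟫_ℂ =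
      ((∫ t in S, t ∂(P.scalar v) : ℝ) : ℂ) := by
  rw [← P.scalar_proj hS]
  exact hP.2 ⟨P.proj S v, _⟩

theorem scalar_Ico_zero (hP : IsSpectralMeasure A P)
    (hA_pos : ∀ v : A.domain, 0 ≤ (⟪(v : E), A v⟫_ℂ).re) (a : ℝ) (v : E) :
    P.scalar v (Ico a 0) = 0 := by
  have h_nonneg := hA_pos ⟨_, hP.proj_mem_domain measurableSet_Ico (Metric.isBounded_Ico a 0) v⟩
  rw [hP.inner_apply_proj measurableSet_Ico (Metric.isBounded_Ico a 0),
    Complex.ofReal_re] at h_nonneg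
  have h_int : IntegrableOn (fun t : ℝ => -t) (Ico a 0) (P.scalar v) :=
    (continuous_neg.integrableOn_Icc).mono_set Ico_subset_Icc_self
  have h_pos := setIntegral_pos_iff_support_of_nonneg_ae
    (ae_restrict_of_forall_mem measurableSet_Ico fun t ht => (neg_pos.2 ht.2).le) h_int
  have h_supp : Function.support (fun t : ℝ => -t) ∩ Ico a 0 = Ico a 0 :=
    inter_eq_right.2 fun t ht => (neg_pos.2 ht.2).ne'
  rw [h_supp, integral_neg] at h_pos
  by_contra h
  linarith [h_pos.2 (pos_iff_ne_zero.2 h)]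

theorem proj_Iio_zero (hP : IsSpectralMeasure A P)
    (hA_pos : ∀ v : A.domain, 0 ≤ (⟪(v : E), A v⟫_ℂ).re) : P.proj (Iio 0) = 0 := by
  ext v
  have h_sub : Iio (0 : ℝ) ⊆ ⋃ n : ℕ, Ico (-(n : ℝ)) 0 := fun t ht => by
    obtain ⟨n, hn⟩ := exists_nat_gt (-t)
    exact mem_iUnion.2 ⟨n, neg_le.1 hn.le, ht⟩
  have h_null : P.scalar v (Iio 0) = 0 :=
    measure_mono_null h_sub (measure_iUnion_null fun n => hP.scalar_Ico_zero hA_pos _ v)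
  have h_norm := P.norm_sq_proj (measurableSet_Iio (a := 0)) v
  rw [measureReal_def, h_null, ENNReal.toReal_zero] at h_norm
  simpa using h_norm

theorem apply_proj_singleton_zero (hP : IsSpectralMeasure A P) (hA : IsSelfAdjoint A)
    (hA_pos : ∀ v : A.domain, 0 ≤ (⟪(v : E), A v⟫_ℂ).re) (v : E) :
    A ⟨_, hP.proj_mem_domain (.singleton 0) Bornology.isBounded_singleton v⟩ = 0 := by
  refine apply_eq_zero_of_inner_apply_eq_zero hA hA_pos ?_
  rw [hP.inner_apply_proj (.singleton 0) Bornology.isBounded_singleton, integral_singleton,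
    smul_zero, Complex.ofReal_zero]

end IsSpectralMeasure

theorem IsSpectralMeasure.proj_Iic_zero_comp_opSqrt (hP : IsSpectralMeasure A P)
    (hA : IsSelfAdjoint A) (hA_pos : ∀ v : A.domain, 0 ≤ (⟪(v : E), A v⟫_ℂ).re)
    {ρ : E →L[ℂ] E} (hρ : ρ.IsPositive) (hρ_ker : ∀ v : A.domain, A v = 0 → ρ v = 0) :
    P.proj (Iic 0) ∘L opSqrt ρ = 0 := by
  have h_zero : opSqrt ρ ∘L P.proj {0} = 0 := by
    ext v
    have h := norm_sq_opSqrt_apply hρ (P.proj {0} v)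
    rw [hρ_ker _ (hP.apply_proj_singleton_zero hA hA_pos v), inner_zero_right] at h
    simpa using h
  rw [← Iio_union_right, P.proj_union measurableSet_Iio (.singleton 0) (by simp),
    hP.proj_Iio_zero hA_pos, zero_add]
  have h_adj := congrArg star h_zero
  rwa [← ContinuousLinearMap.mul_def, star_mul, star_zero,
    (P.isStarProjection _ (.singleton 0)).isSelfAdjoint.star_eq,
    (isSelfAdjoint_opSqrt ρ).star_eq] at h_adj

end SpectralMeasure

section MeasureComparison

variable {X : Type*} [MeasurableSpace X] {ν κ η μ : Measure X}

theorem lintegral_le_lintegral_meas_lt (ν : Measure X) (f : X → ℝ≥0∞) :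
    ∫⁻ x, f x ∂ν ≤ ∫⁻ t in Ioi (0 : ℝ), ν {x | ENNReal.ofReal t < f x} := by
  obtain ⟨g, hg_meas, hgf, hg_eq⟩ := exists_measurable_le_lintegral_eq ν f
  have h_sup : ∀ x, g x = ⨆ n : ℕ, min (g x) n := fun x => by
    rw [← inf_iSup_eq, ENNReal.iSup_natCast, inf_top_eq]
  have h_mono : Monotone fun (n : ℕ) x => min (g x) n := fun m n hmn x => by
    dsimp only
    gcongr
  rw [hg_eq, lintegral_congr h_sup, lintegral_iSup (fun n => by fun_prop) h_mono]
  refine iSup_le fun n => ?_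
  have h_fin : ∀ x, min (g x) (n : ℝ≥0∞) ≠ ∞ := fun x =>
    ne_top_of_le_ne_top (ENNReal.natCast_ne_top n) (min_le_right _ _)
  calc ∫⁻ x, min (g x) n ∂ν
      = ∫⁻ x, ENNReal.ofReal (min (g x) n).toReal ∂ν :=
        lintegral_congr fun x => (ENNReal.ofReal_toReal (h_fin x)).symm
    _ = ∫⁻ t in Ioi (0 : ℝ), ν {x | t < (min (g x) n).toReal} :=
        lintegral_eq_lintegral_meas_lt ν (ae_of_all _ fun _ => ENNReal.toReal_nonneg) (by fun_prop)
    _ ≤ ∫⁻ t in Ioi (0 : ℝ), ν {x | ENNReal.ofReal t < f x} :=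
        setLIntegral_mono' measurableSet_Ioi fun t ht => measure_mono fun x hx =>
          ((ENNReal.ofReal_lt_iff_lt_toReal (le_of_lt ht) (h_fin x)).2 hx).trans_le
            ((min_le_left _ _).trans (hgf x))

theorem lintegral_ofReal_eq_lintegral_meas_Ioi (ν : Measure ℝ) :
    ∫⁻ t, ENNReal.ofReal t ∂ν = ∫⁻ t in Ioi (0 : ℝ), ν (Ioi t) := by
  calc ∫⁻ t, ENNReal.ofReal t ∂ν
      = ∫⁻ t, ENNReal.ofReal (max t 0) ∂ν := by simp [ENNReal.ofReal_max]
    _ = ∫⁻ t in Ioi (0 : ℝ), ν {s | t < max s 0} :=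
        lintegral_eq_lintegral_meas_lt ν (ae_of_all _ fun t => le_max_right t 0) (by fun_prop)
    _ = ∫⁻ t in Ioi (0 : ℝ), ν (Ioi t) :=
        setLIntegral_congr_fun measurableSet_Ioi fun t (ht : 0 < t) => by
          simp [Ioi, ht.not_gt]

theorem withDensity_rnDeriv_of_absolutelyContinuous [SigmaFinite μ] (h : ν ≪ μ) :
    μ.withDensity (ν.rnDeriv μ) = ν := by
  set S := ν.sigmaFiniteSetWRT μ
  have hν : ν = ν.restrict S + (∞ : ℝ≥0∞) • μ.restrict Sᶜ := by
    rw [← restrict_compl_sigmaFiniteSetWRT h,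
      Measure.restrict_add_restrict_compl measurableSet_sigmaFiniteSetWRT]
  have : ν.HaveLebesgueDecomposition μ := by
    rw [hν]
    infer_instance
  exact Measure.withDensity_rnDeriv_eq ν μ h

theorem setLIntegral_rnDeriv_of_absolutelyContinuous [SigmaFinite μ] (h : ν ≪ μ) {S : Set X}
    (hS : MeasurableSet S) : ∫⁻ x in S, ν.rnDeriv μ x ∂μ = ν S := by
  rw [← withDensity_apply _ hS, withDensity_rnDeriv_of_absolutelyContinuous h]

theorem rnDeriv_le_of_le_smul_add [SigmaFinite μ] (hν : ν ≪ μ) (hκ : κ ≪ μ) (hη : η ≪ μ)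
    {c : ℝ≥0∞} (h : ν ≤ c • κ + η) :
    ∀ᵐ x ∂μ, ν.rnDeriv μ x ≤ c * κ.rnDeriv μ x + η.rnDeriv μ x := by
  refine ae_le_of_forall_setLIntegral_le_of_sigmaFinite (by fun_prop) fun S hS _ => ?_
  rw [lintegral_add_left (by fun_prop), lintegral_const_mul _ (by fun_prop),
    setLIntegral_rnDeriv_of_absolutelyContinuous hν hS,
    setLIntegral_rnDeriv_of_absolutelyContinuous hκ hS,
    setLIntegral_rnDeriv_of_absolutelyContinuous hη hS]
  exact h S

theorem le_two_mul_of_le_mul_add {a b c d : ℝ≥0∞} (hc : c ≠ ∞) (hb : b ≠ ∞)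
    (h : a ≤ c * b + d) (hba : 2 * (c * b) ≤ a) : a ≤ 2 * d := by
  have hcb : c * b ≠ ∞ := ENNReal.mul_ne_top hc hb
  have hbd : c * b ≤ d := by
    refine ENNReal.le_of_add_le_add_left hcb ?_
    rw [← two_mul]
    exact hba.trans h
  calc a ≤ c * b + d := h
    _ ≤ d + d := by gcongr
    _ = 2 * d := (two_mul d).symm

theorem measure_setOf_rnDeriv_le_div [SigmaFinite μ] (hν : ν ≪ μ) (hκ : κ ≪ μ) (hη : η ≪ μ)
    {c : ℝ≥0∞} (hc₀ : c ≠ 0) (hc : c ≠ ∞) (h : ν ≤ c • κ + η) :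
    ν {x | κ.rnDeriv μ x < ∞ ∧ κ.rnDeriv μ x ≤ ν.rnDeriv μ x / (2 * c)} ≤ 2 * η univ := by
  set S := {x | κ.rnDeriv μ x < ∞ ∧ κ.rnDeriv μ x ≤ ν.rnDeriv μ x / (2 * c)}
  have hS : MeasurableSet S :=
    (measurableSet_lt (Measure.measurable_rnDeriv κ μ) measurable_const).inter
      (measurableSet_le (Measure.measurable_rnDeriv κ μ) (by fun_prop))
  have h_le : ∀ᵐ x ∂μ, x ∈ S → ν.rnDeriv μ x ≤ 2 * η.rnDeriv μ x := by
    filter_upwards [rnDeriv_le_of_le_smul_add hν hκ hη h] with x hx ⟨hx_fin, hx_le⟩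
    rw [ENNReal.le_div_iff_mul_le (by simp [hc₀]) (by simp [ENNReal.mul_eq_top, hc]),
      mul_comm, mul_assoc] at hx_le
    exact le_two_mul_of_le_mul_add hc hx_fin.ne hx hx_le
  calc ν S = ∫⁻ x in S, ν.rnDeriv μ x ∂μ :=
        (setLIntegral_rnDeriv_of_absolutelyContinuous hν hS).symm
    _ ≤ ∫⁻ x in S, 2 * η.rnDeriv μ x ∂μ := setLIntegral_mono_ae (by fun_prop) h_le
    _ = 2 * η S := by
        rw [lintegral_const_mul _ (by fun_prop),
          setLIntegral_rnDeriv_of_absolutelyContinuous hη hS]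
    _ ≤ 2 * η univ := by gcongr; exact subset_univ S

end MeasureComparison

section HilbertSchmidt

theorem enorm_sq_eq_ofReal {G : Type*} [NormedAddCommGroup G] (v : G) :
    ‖v‖ₑ ^ 2 = ENNReal.ofReal (‖v‖ ^ 2) := by
  rw [ENNReal.ofReal_pow (norm_nonneg _), ofReal_norm]

theorem enorm_add_sq_le {G : Type*} [NormedAddCommGroup G] (v w : G) :
    ‖v + w‖ₑ ^ 2 ≤ 2 * ‖v‖ₑ ^ 2 + 2 * ‖w‖ₑ ^ 2 := by
  calc ‖v + w‖ₑ ^ 2 ≤ (‖v‖ₑ + ‖w‖ₑ) ^ 2 := by gcongr; exact enorm_add_le v w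
    _ ≤ 2 * (‖v‖ₑ ^ 2 + ‖w‖ₑ ^ 2) := by
        simpa [show (2 : ℝ) - 1 = 1 by norm_num] using
          ENNReal.rpow_add_le_mul_rpow_add_rpow ‖v‖ₑ ‖w‖ₑ one_le_two
    _ = 2 * ‖v‖ₑ ^ 2 + 2 * ‖w‖ₑ ^ 2 := mul_add _ _ _

variable {E : Type*} [NormedAddCommGroup E] [InnerProductSpace ℂ E]

theorem enorm_sq_eq_tsum_enorm_inner_sq {ι : Type*} (b : HilbertBasis ι ℂ E) (v : E) :
    ‖v‖ₑ ^ 2 = ∑' i, ‖⟪b i, v⟫_ℂ‖ₑ ^ 2 := by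
  have h_sum : HasSum (fun i => ‖⟪b i, v⟫_ℂ‖ ^ 2) (‖v‖ ^ 2) := by
    convert Complex.hasSum_re (b.hasSum_inner_mul_inner v v) using 2 with i
    · rw [← inner_conj_symm v, Complex.conj_mul', ← Complex.ofReal_pow, Complex.ofReal_re]
    · exact (inner_self_eq_norm_sq (𝕜 := ℂ) v).symm
  simp only [enorm_sq_eq_ofReal]
  rw [← h_sum.tsum_eq, ENNReal.ofReal_tsum_of_nonneg (fun i => by positivity) h_sum.summable]

variable [CompleteSpace E]

theorem formTrace_mono {p q : E → ℝ≥0∞} (h : p ≤ q) : formTrace p ≤ formTrace q :=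
  ENNReal.tsum_le_tsum fun i => h i

theorem formTrace_add (p q : E → ℝ≥0∞) :
    formTrace (fun v => p v + q v) = formTrace p + formTrace q :=
  ENNReal.tsum_add

theorem formTrace_const_mul (c : ℝ≥0∞) (q : E → ℝ≥0∞) :
    formTrace (fun v => c * q v) = c * formTrace q :=
  ENNReal.tsum_mul_left

theorem formTrace_enorm_sq_adjoint (T : E →L[ℂ] E) :
    formTrace (fun v => ‖ContinuousLinearMap.adjoint T v‖ₑ ^ 2) =
      formTrace fun v => ‖T v‖ₑ ^ 2 := by
  obtain ⟨b, hb⟩ := (exists_hilbertBasis ℂ E).choose_spec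
  simp only [formTrace, enorm_sq_eq_tsum_enorm_inner_sq b, hb]
  rw [ENNReal.tsum_comm]
  refine tsum_congr fun i => tsum_congr fun j => ?_
  rw [ContinuousLinearMap.adjoint_inner_right, ← inner_conj_symm, RCLike.enorm_conj]

theorem formTrace_enorm_sq_comp_le (S T : E →L[ℂ] E) :
    formTrace (fun v => ‖S (T v)‖ₑ ^ 2) ≤ ‖T‖ₑ ^ 2 * formTrace fun v => ‖S v‖ₑ ^ 2 := by
  have h_norm : ‖ContinuousLinearMap.adjoint T‖ₑ = ‖T‖ₑ := by
    rw [← ofReal_norm, LinearIsometryEquiv.norm_map, ofReal_norm]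
  calc formTrace (fun v => ‖(S ∘L T) v‖ₑ ^ 2)
      = formTrace fun v =>
          ‖ContinuousLinearMap.adjoint T (ContinuousLinearMap.adjoint S v)‖ₑ ^ 2 := by
        rw [← formTrace_enorm_sq_adjoint, ContinuousLinearMap.adjoint_comp]
        rfl
    _ ≤ formTrace fun v => ‖T‖ₑ ^ 2 * ‖ContinuousLinearMap.adjoint S v‖ₑ ^ 2 :=
        formTrace_mono fun v => by
          dsimp only
          rw [← mul_pow, ← h_norm]
          gcongr
          exact ContinuousLinearMap.le_opENorm _ _
    _ = ‖T‖ₑ ^ 2 * formTrace fun v => ‖S v‖ₑ ^ 2 := by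
        rw [formTrace_const_mul, formTrace_enorm_sq_adjoint]

theorem enorm_opSqrt_sq {ρ : E →L[ℂ] E} (hρ : ρ.IsPositive) : ‖opSqrt ρ‖ₑ ^ 2 = ‖ρ‖ₑ := by
  rw [enorm_sq_eq_ofReal, ← (isSelfAdjoint_opSqrt ρ).norm_mul_self, opSqrt_mul_opSqrt hρ,
    ofReal_norm]

theorem opSqrt_of_isStarProjection {Q : E →L[ℂ] E} (hQ : IsStarProjection Q) : opSqrt Q = Q :=
  CFC.sqrt_unique hQ.isIdempotentElem.eq hQ.nonneg

end HilbertSchmidt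

section HilbertSchmidtMeasure

variable {X : Type*} [MeasurableSpace X] {μ : Measure X}

theorem lintegral_enorm_sq_Lp {G : Type*} [NormedAddCommGroup G] (f : Lp G 2 μ) :
    ∫⁻ x, ‖f x‖ₑ ^ 2 ∂μ = ‖f‖ₑ ^ 2 := by
  simpa [Lp.enorm_def] using (eLpNorm_nnreal_pow_eq_lintegral (f := f) (μ := μ) two_ne_zero).symm

variable {H : Type*} [NormedAddCommGroup H] [InnerProductSpace ℂ H]

theorem setLIntegral_enorm_sq_Lp {Ω : Set X} (hΩ : MeasurableSet Ω) (f : Lp H 2 μ) :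
    ∫⁻ x in Ω, ‖f x‖ₑ ^ 2 ∂μ = ‖cutoff μ Ω hΩ f‖ₑ ^ 2 := by
  rw [← lintegral_enorm_sq_Lp, ← lintegral_indicator hΩ]
  refine lintegral_congr_ae ?_
  filter_upwards [coeFn_cutoff μ Ω hΩ f] with x hx
  rw [hx]
  by_cases h : x ∈ Ω <;> simp [h]

variable [CompleteSpace H]

/-- The measure `Ω ↦ ‖χ_Ω T‖²`, with the Hilbert–Schmidt norm, of a bounded operator `T` on
`L²(X, H)`. It is `ν_P` for `T = P^{1/2}`, but it also applies to the products `(1 - Q) ρ^{1/2}`,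
which need not be positive. -/
def hilbertSchmidtMeasure (T : Lp H 2 μ →L[ℂ] Lp H 2 μ) : Measure X :=
  Measure.sum fun i : (exists_hilbertBasis ℂ (Lp H 2 μ)).choose =>
    μ.withDensity fun x => ‖T (i : Lp H 2 μ) x‖ₑ ^ 2

variable (S T P : Lp H 2 μ →L[ℂ] Lp H 2 μ) {Ω : Set X}

theorem hilbertSchmidtMeasure_apply (hΩ : MeasurableSet Ω) :
    hilbertSchmidtMeasure T Ω = formTrace fun v => ∫⁻ x in Ω, ‖T v x‖ₑ ^ 2 ∂μ := by
  rw [hilbertSchmidtMeasure, Measure.sum_apply _ hΩ, formTrace]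
  simp only [withDensity_apply _ hΩ]

theorem hilbertSchmidtMeasure_apply_cutoff (hΩ : MeasurableSet Ω) :
    hilbertSchmidtMeasure T Ω = formTrace fun v => ‖cutoff μ Ω hΩ (T v)‖ₑ ^ 2 := by
  simp only [hilbertSchmidtMeasure_apply T hΩ, setLIntegral_enorm_sq_Lp hΩ]

theorem hilbertSchmidtMeasure_univ :
    hilbertSchmidtMeasure T univ = formTrace fun v => ‖T v‖ₑ ^ 2 := by
  simp only [hilbertSchmidtMeasure_apply T .univ, Measure.restrict_univ, lintegral_enorm_sq_Lp]

theorem hilbertSchmidtMeasure_absolutelyContinuous : hilbertSchmidtMeasure T ≪ μ :=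
  Measure.absolutelyContinuous_sum_left fun _ => withDensity_absolutelyContinuous _ _

theorem hilbertSchmidtMeasure_comp_le :
    hilbertSchmidtMeasure (S ∘L T) ≤ ‖T‖ₑ ^ 2 • hilbertSchmidtMeasure S :=
  Measure.le_iff.2 fun Ω hΩ => by
    rw [Measure.smul_apply, smul_eq_mul, hilbertSchmidtMeasure_apply_cutoff _ hΩ,
      hilbertSchmidtMeasure_apply_cutoff _ hΩ]
    simpa only [ContinuousLinearMap.comp_apply] using
      formTrace_enorm_sq_comp_le (cutoff μ Ω hΩ ∘L S) T

theorem hilbertSchmidtMeasure_add_le :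
    hilbertSchmidtMeasure (S + T) ≤
      (2 : ℝ≥0∞) • hilbertSchmidtMeasure S + (2 : ℝ≥0∞) • hilbertSchmidtMeasure T :=
  Measure.le_iff.2 fun Ω hΩ => by
    simp only [Measure.add_apply, Measure.smul_apply, smul_eq_mul,
      hilbertSchmidtMeasure_apply_cutoff _ hΩ, ← formTrace_const_mul, ← formTrace_add]
    refine formTrace_mono fun v => ?_
    dsimp only
    rw [add_apply, map_add]
    exact enorm_add_sq_le _ _

theorem traceMeasure_eq_hilbertSchmidtMeasure :
    traceMeasure μ P = hilbertSchmidtMeasure (opSqrt P) := by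
  ext Ω hΩ
  rw [traceMeasure, Measure.ofMeasurable_apply Ω hΩ, trace_sqrt_cutoff_sqrt,
    hilbertSchmidtMeasure_apply _ hΩ]

theorem traceMeasure_absolutelyContinuous : traceMeasure μ P ≪ μ := by
  rw [traceMeasure_eq_hilbertSchmidtMeasure]
  exact hilbertSchmidtMeasure_absolutelyContinuous _

variable {ρ Q : Lp H 2 μ →L[ℂ] Lp H 2 μ}

theorem traceMeasure_le_smul_add (hρ : ρ.IsPositive) (hQ : IsStarProjection Q) :
    traceMeasure μ ρ ≤ (2 * ‖ρ‖ₑ) • traceMeasure μ Q +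
      (2 : ℝ≥0∞) • hilbertSchmidtMeasure ((1 - Q) ∘L opSqrt ρ) := by
  have h_split : opSqrt ρ = Q ∘L opSqrt ρ + (1 - Q) ∘L opSqrt ρ := by
    ext1 v
    simp
  calc traceMeasure μ ρ
      = hilbertSchmidtMeasure (Q ∘L opSqrt ρ + (1 - Q) ∘L opSqrt ρ) := by
        rw [← h_split, traceMeasure_eq_hilbertSchmidtMeasure]
    _ ≤ (2 : ℝ≥0∞) • hilbertSchmidtMeasure (Q ∘L opSqrt ρ) +
          (2 : ℝ≥0∞) • hilbertSchmidtMeasure ((1 - Q) ∘L opSqrt ρ) :=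
        hilbertSchmidtMeasure_add_le _ _
    _ ≤ (2 : ℝ≥0∞) • ‖opSqrt ρ‖ₑ ^ 2 • hilbertSchmidtMeasure Q +
          (2 : ℝ≥0∞) • hilbertSchmidtMeasure ((1 - Q) ∘L opSqrt ρ) := by
        gcongr
        exact hilbertSchmidtMeasure_comp_le _ _
    _ = _ := by
        rw [enorm_opSqrt_sq hρ, smul_smul, traceMeasure_eq_hilbertSchmidtMeasure,
          opSqrt_of_isStarProjection hQ]

theorem traceMeasure_setOf_density_le [SigmaFinite μ] (hρ : ρ.IsPositive) (hρ_ne : ρ ≠ 0)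
    (hQ : IsStarProjection Q) :
    traceMeasure μ ρ {x | density μ Q x < ∞ ∧
        density μ Q x ≤ density μ ρ x / ENNReal.ofReal (4 * ‖ρ‖)} ≤
      4 * formTrace fun v => ‖((1 - Q) ∘L opSqrt ρ) v‖ₑ ^ 2 := by
  have h_four : ENNReal.ofReal (4 * ‖ρ‖) = 2 * (2 * ‖ρ‖ₑ) := by
    rw [ENNReal.ofReal_mul zero_le_four, ofReal_norm, ← mul_assoc]
    norm_num
  have h := measure_setOf_rnDeriv_le_div (c := 2 * ‖ρ‖ₑ) (traceMeasure_absolutelyContinuous ρ)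
    (traceMeasure_absolutelyContinuous Q)
    ((hilbertSchmidtMeasure_absolutelyContinuous _).smul_left (2 : ℝ≥0∞)) (by simpa using hρ_ne)
    (by finiteness) (traceMeasure_le_smul_add hρ hQ)
  rw [h_four]
  refine h.trans_eq ?_
  rw [Measure.smul_apply, smul_eq_mul, hilbertSchmidtMeasure_univ, ← mul_assoc]
  norm_num

end HilbertSchmidtMeasure

section Energy

variable {E : Type*} [NormedAddCommGroup E] [InnerProductSpace ℂ E] [CompleteSpace E]
  (A : E →ₗ.[ℂ] E) (ρ : E →L[ℂ] E)

/-- The measure `S ↦ τ(ρ^{1/2} χ_A(S) ρ^{1/2})` on the spectrum of `A`, whose first moment is the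
energy of `ρ`. -/
def energyDistribution : Measure ℝ :=
  Measure.sum fun i : (exists_hilbertBasis ℂ E).choose =>
    (spectralMeasure A).scalar (opSqrt ρ (i : E))

theorem energyDistribution_apply {S : Set ℝ} (hS : MeasurableSet S) :
    energyDistribution A ρ S =
      formTrace fun v => ‖(spectralProjection A S ∘L opSqrt ρ) v‖ₑ ^ 2 := by
  rw [energyDistribution, Measure.sum_apply _ hS, formTrace]
  simp only [ProjectionValuedMeasure.scalar_apply _ _ hS, enorm_sq_eq_ofReal]
  rfl

theorem energy_eq_lintegral_energyDistribution_Ioi :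
    energy A ρ = ∫⁻ t in Ioi (0 : ℝ), energyDistribution A ρ (Ioi t) := by
  rw [← lintegral_ofReal_eq_lintegral_meas_Ioi, energyDistribution, lintegral_sum_measure]
  rfl

end Energy

section MoserInequality

theorem lt_top_and_le_of_lt_genInverse {f : ℝ≥0 → ℝ≥0∞} (hf : Monotone f) {u : ℝ≥0∞} {t : ℝ≥0}
    (h : t < genInverse f u) : f t < ∞ ∧ f t ≤ u := by
  obtain ⟨s, ⟨hs_fin, hs_le⟩, hts⟩ := by simpa only [genInverse, lt_iSup_iff] using h
  have hfts : f t ≤ f s := hf (ENNReal.coe_lt_coe.1 hts).le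
  exact ⟨hfts.trans_lt hs_fin, hfts.trans hs_le⟩

variable {X : Type*} [MeasurableSpace X] {μ : Measure X} [SigmaFinite μ]
  {H : Type*} [NormedAddCommGroup H] [InnerProductSpace ℂ H] [CompleteSpace H]
  {A : Lp H 2 μ →ₗ.[ℂ] Lp H 2 μ} {ρ : Lp H 2 μ →L[ℂ] Lp H 2 μ}
  {Q : ℝ≥0 → (Lp H 2 μ →L[ℂ] Lp H 2 μ)} {F : X → ℝ≥0 → ℝ≥0∞}

theorem traceMeasure_setOf_lt_genInverse_le (hρ : ρ.IsPositive) (hρ_ne : ρ ≠ 0)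
    (hQ : ∀ t, IsStarProjection (Q t)) (hF : IsPointwiseDensity μ Q F) (t : ℝ≥0) :
    traceMeasure μ ρ {x | t < genInverse (F x) (density μ ρ x / ENNReal.ofReal (4 * ‖ρ‖))} ≤
      4 * formTrace fun v => ‖((1 - Q t) ∘L opSqrt ρ) v‖ₑ ^ 2 := by
  refine (measure_mono_ae ?_).trans (traceMeasure_setOf_density_le hρ hρ_ne (hQ t))
  refine (traceMeasure_absolutelyContinuous ρ).ae_le ?_
  filter_upwards [hF.1, hF.2 t] with x hx_mono hx_eq hx_lt
  have h := lt_top_and_le_of_lt_genInverse hx_mono hx_lt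
  rwa [hx_eq] at h

theorem lintegral_genInverse_le (hρ : ρ.IsPositive) (hρ_ne : ρ ≠ 0)
    (hQ : ∀ t, IsStarProjection (Q t))
    (hQA : ∀ t : ℝ≥0, (1 - Q t) ∘L opSqrt ρ = spectralProjection A (Ioi (t : ℝ)) ∘L opSqrt ρ)
    (hF : IsPointwiseDensity μ Q F) :
    ∫⁻ x, genInverse (F x) (density μ ρ x / ENNReal.ofReal (4 * ‖ρ‖)) ∂(traceMeasure μ ρ) ≤
      4 * energy A ρ := by
  set g : X → ℝ≥0∞ := fun x => genInverse (F x) (density μ ρ x / ENNReal.ofReal (4 * ‖ρ‖))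
  calc ∫⁻ x, g x ∂(traceMeasure μ ρ)
      ≤ ∫⁻ t in Ioi (0 : ℝ), traceMeasure μ ρ {x | ENNReal.ofReal t < g x} :=
        lintegral_le_lintegral_meas_lt _ g
    _ ≤ ∫⁻ t in Ioi (0 : ℝ), 4 * energyDistribution A ρ (Ioi t) :=
        setLIntegral_mono' measurableSet_Ioi fun t ht => by
          refine (traceMeasure_setOf_lt_genInverse_le hρ hρ_ne hQ hF t.toNNReal).trans_eq ?_
          rw [hQA, energyDistribution_apply A ρ measurableSet_Ioi,
            Real.coe_toNNReal t (le_of_lt ht)]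
    _ = 4 * energy A ρ := by
        rw [lintegral_const_mul' _ _ (by simp), ← energy_eq_lintegral_energyDistribution_Ioi]

end MoserInequality

end MixedState

end

theorem mainTheorem3 {X : Type*} [MeasurableSpace X] (μ : Measure X) [SigmaFinite μ]
    {H : Type*} [NormedAddCommGroup H] [InnerProductSpace ℂ H] [CompleteSpace H]
    (A : Lp H 2 μ →ₗ.[ℂ] Lp H 2 μ) (hA : IsSelfAdjoint A)
    (hA_pos : ∀ v : A.domain, 0 ≤ (⟪(v : Lp H 2 μ), A v⟫_ℂ).re)
    (ρ : Lp H 2 μ →L[ℂ] Lp H 2 μ) (hρ : ρ.IsPositive) (hρ_ne : ρ ≠ 0)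
    (F : X → ℝ≥0 → ℝ≥0∞)
    (hF : ((∀ v : A.domain, A v = 0 → ρ v = 0) ∧
        MixedState.IsPointwiseDensity μ
          (fun t => MixedState.spectralProjection A (Ioc 0 (t : ℝ))) F) ∨
      MixedState.IsPointwiseDensity μ
        (fun t => MixedState.spectralProjection A (Icc 0 (t : ℝ))) F) :
    ∫⁻ x, MixedState.genInverse (F x)
        (MixedState.density μ ρ x / ENNReal.ofReal (4 * ‖ρ‖)) ∂(MixedState.traceMeasure μ ρ) ≤
      4 * MixedState.energy A ρ := by
  set P := MixedState.spectralMeasure A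
  have hP : MixedState.IsSpectralMeasure A P :=
    MixedState.isSpectralMeasure_spectralMeasure hA hA_pos
  rcases hF with ⟨hρ_ker, hF⟩ | hF
  · refine MixedState.lintegral_genInverse_le hρ hρ_ne
      (fun t => P.isStarProjection _ measurableSet_Ioc) (fun t => ?_) hF
    refine P.one_sub_proj_comp measurableSet_Ioc measurableSet_Ioi Ioc_disjoint_Ioi_same ?_
    rw [Ioc_union_Ioi_eq_Ioi t.coe_nonneg, compl_Ioi]
    exact hP.proj_Iic_zero_comp_opSqrt hA hA_pos hρ hρ_ker
  · refine MixedState.lintegral_genInverse_le hρ hρ_ne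
      (fun t => P.isStarProjection _ measurableSet_Icc) (fun t => ?_) hF
    refine P.one_sub_proj_comp measurableSet_Icc measurableSet_Ioi
      (disjoint_left.2 fun s hs => not_lt_of_ge hs.2) ?_
    rw [Icc_union_Ioi_eq_Ici t.coe_nonneg, compl_Ici, hP.proj_Iio_zero hA_pos,
      ContinuousLinearMap.zero_comp]
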